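/- Let $G$ be a finite simple graph on the vertex set $[n]$ with at least one edge, and suppose that its complementary graph $G^c$ is chordal, i.e. every cycle of length $>3$ in $G^c$ has a chord. Let $S=K[x_1,\dots,x_n]$ be the polynomial ring over a field $K$, and let $J(G)\subset S$ be the vertex cover ideal of $G$, generated by the monomials $\prod_{i\in W}x_i$ with $W$ a minimal vertex cover of $G$. Let $\Delta(G^c)$ be the clique complex of $G^c$, the simplicial complex of all cliques of $G^c$. Definitions. (a) For a simplicial complex $\Delta$ and a facet $F$ of $\Delta$, a branch of $F$ in $\Delta$ is a facet $B\neq F$ of $\Delta$ such that $H\cap F\subseteq B\cap F$ for every facet $H\neq F$ of $\Delta$; $F$ is a leaf of $\Delta$ if it has a branch. A leaf order of $\Delta$ is a labelling $F_1,\dots,F_q$ of all the facets of $\Delta$ (without repetition) such that for $1<i\le q$ the facet $F_i$ is a leaf of $\langle F_1,\dots,F_i\rangle$, the complex of all subsets of the sets $F_1,\dots,F_i$. A leaf order is sensitive if (1) for every $1<i\le q$ the facet $F_i$ has exactly one branch $G_i$ in $\langle F_1,\dots,F_i\rangle$, and (2) $G_i\cap F_i\not\subseteq G_j\cap F_j$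 for all $i\ne j$ in $\{2,\dots,q\}$. (b) Let $I\subset S$ be a monomial ideal with minimal monomial generators $m_1,\dots,m_q$, and put $m_\sigma=\operatorname{lcm}(m_i : i\in\sigma)$ for $\sigma\subseteq\{1,\dots,q\}$. The Scarf complex of $I$ is the simplicial complex of all $\sigma$ such that $m_\tau\neq m_\sigma$ for all $\tau\neq\sigma$. The ideal $I$ has a Scarf resolution if its Scarf complex supports a minimal free resolution of $I$, that is, if the complex of free $S$-modules with basis $e_\sigma$ ($\sigma$ a nonempty face of the Scarf complex, in homological degree $|\sigma|-1$) and differential $e_\sigma\mapsto\sum_{a\in\sigma}\pm\frac{m_\sigma}{m_{\sigma\setminus a}}e_{\sigma\setminus a}$ (with the usual simplicial signs), augmented by $e_{\{i\}}\mapsto m_i$, is a minimal free resolution of $I$. Theorem. The following conditions are equivalent: (i) the vertex cover ideal $J(G)$ has a Scarf resolution; (ii) some leaf order of $\Delta(G^c)$ is sensitive; (iii) every leaf order of $\Delta(G^c)$ is sensitive. -/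

import Mathlib

namespace ScarfCover

/-! ### Simplicial complexes, leaves, leaf orders

A simplicial complex on `V` is a family of finite subsets of `V` closed under passing to subsets,
that is, a `LowerSet (Finset V)` (the empty set counts as a face). -/

section Combinatorics

variable {V : Type*}

/-- A facet is a maximal face. -/
def IsFacet (Δ : LowerSet (Finset V)) (F : Finset V) : Prop :=
  Maximal (fun A => A ∈ Δ) F

/-- The complex of all cliques of `H`. -/
def cliqueComplex (H : SimpleGraph V) : LowerSet (Finset V) where
  carrier := {A | H.IsClique (A : Set V)}
  lower' := fun _ _ hBA hA => hA.subset (Finset.coe_subset.2 hBA)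

/-- `⟨F_0, …, F_i⟩`: the complex of all subsets of some `F_j` with `j ≤ i`. -/
def initialComplex {q : ℕ} (F : Fin q → Finset V) (i : Fin q) : LowerSet (Finset V) where
  carrier := {A | ∃ j ≤ i, A ⊆ F j}
  lower' := fun _ _ hBA ⟨j, hj, hA⟩ => ⟨j, hj, Finset.Subset.trans hBA hA⟩

/-- A graph is chordal if every cycle of length `> 3` has a chord: an edge of the graph which joins
two vertices of the cycle and is not an edge of the cycle. -/
def IsChordal (H : SimpleGraph V) : Prop :=
  ∀ (v : V) (c : H.Walk v v), c.IsCycle → 3 < c.length →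
    ∃ a ∈ c.support, ∃ b ∈ c.support, H.Adj a b ∧ s(a, b) ∉ c.edges

variable [DecidableEq V]

/-- `B` is a branch of `F` in `Δ`. -/
def IsBranch (Δ : LowerSet (Finset V)) (F B : Finset V) : Prop :=
  IsFacet Δ B ∧ B ≠ F ∧ ∀ H, IsFacet Δ H → H ≠ F → H ∩ F ⊆ B ∩ F

/-- `F` is a leaf of `Δ`: a facet that has a branch. -/
def IsLeaf (Δ : LowerSet (Finset V)) (F : Finset V) : Prop :=
  IsFacet Δ F ∧ ∃ B, IsBranch Δ F B

/-- `F_0, …, F_{q-1}` is a labelling (without repetition) of all facets of `Δ` such that every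
`F_i` other than the first one is a leaf of `⟨F_0, …, F_i⟩`. -/
structure IsLeafOrder (Δ : LowerSet (Finset V)) {q : ℕ} (F : Fin q → Finset V) : Prop where
  injective : Function.Injective F
  range_eq : Set.range F = {A | IsFacet Δ A}
  isLeaf : ∀ i : Fin q, 0 < (i : ℕ) → IsLeaf (initialComplex F i) (F i)

/-- Every `F_i` other than the first one has exactly one branch `G_i` in `⟨F_0, …, F_i⟩`, and
`G_i ∩ F_i` is not contained in `G_j ∩ F_j` for `i ≠ j`. -/
structure IsSensitive {q : ℕ} (F : Fin q → Finset V) : Prop where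
  unique_branch : ∀ i : Fin q, 0 < (i : ℕ) → ∃! B, IsBranch (initialComplex F i) (F i) B
  incomparable : ∀ i j : Fin q, 0 < (i : ℕ) → 0 < (j : ℕ) → i ≠ j →
    ∀ B C, IsBranch (initialComplex F i) (F i) B → IsBranch (initialComplex F j) (F j) C →
      ¬ (B ∩ F i ⊆ C ∩ F j)

end Combinatorics

/-! ### The Scarf complex of a monomial ideal -/

noncomputable section Scarf

variable {V : Type*} {q : ℕ}

/-- The exponent of the least common multiple of the monomials `x ^ u i`, `i ∈ σ`. -/
def lcmExp (u : Fin q → V →₀ ℕ) (σ : Finset (Fin q)) : V →₀ ℕ := σ.sup u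

/-- The Scarf complex of the monomials `x ^ u 0, …, x ^ u (q-1)`: the sets of indices whose least
common multiple is not the least common multiple of any other set of indices. -/
def scarfComplex (u : Fin q → V →₀ ℕ) : LowerSet (Finset (Fin q)) where
  carrier := {σ | ∀ τ, lcmExp u τ = lcmExp u σ → τ = σ}
  lower' := by
    intro σ τ hτσ hσ ρ hρ
    have hτσ' : τ ⊆ σ := hτσ
    have h1 : ρ ∪ (σ \ τ) = σ := by
      apply hσ
      have h := congrArg (fun m => m ⊔ lcmExp u (σ \ τ)) hρ
      simp only [lcmExp, ← Finset.sup_union, Finset.union_sdiff_of_subset hτσ'] at h ⊢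
      exact h
    have h2 : τ ∪ (σ \ ρ) = σ := by
      have hρσ : ρ ⊆ σ := h1 ▸ Finset.subset_union_left
      apply hσ
      have h := congrArg (fun m => m ⊔ lcmExp u (σ \ ρ)) hρ
      simp only [lcmExp, ← Finset.sup_union, Finset.union_sdiff_of_subset hρσ] at h ⊢
      exact h.symm
    ext a
    have e1 := Finset.ext_iff.1 h1 a
    have e2 := Finset.ext_iff.1 h2 a
    have e3 := @hτσ' a
    simp only [Finset.mem_union, Finset.mem_sdiff] at e1 e2
    tauto

/-- The faces of dimension `d`, that is, with `d + 1` elements. -/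
abbrev Face (Δ : LowerSet (Finset (Fin q))) (d : ℕ) : Type :=
  {σ : Finset (Fin q) // σ ∈ Δ ∧ σ.card = d + 1}

/-- The face `σ \ {a}` of a face `σ`. -/
def Face.erase {Δ : LowerSet (Finset (Fin q))} {d : ℕ} (σ : Face Δ (d + 1))
    (a : {a // a ∈ σ.1}) : Face Δ d :=
  ⟨σ.1.erase a.1, Δ.lower (Finset.erase_subset _ _) σ.2.1, by
    rw [Finset.card_erase_of_mem a.2, σ.2.2]; rfl⟩

variable (K : Type*) [Field K]

/-- The free module in homological degree `d` of the homogenized chain complex of `Δ`. -/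
abbrev FaceModule (V : Type*) (Δ : LowerSet (Finset (Fin q))) (d : ℕ) : Type _ :=
  Face Δ d →₀ MvPolynomial V K

/-- The differential of the chain complex of `Δ` homogenized by the labels `x ^ u i`:
`e_σ ↦ ∑_{a ∈ σ} ± (m_σ / m_{σ \ a}) e_{σ \ a}`, where `m_σ` is the least common multiple of
the labels on `σ` and the sign is given by the position of `a` in `σ`. -/
def boundary (u : Fin q → V →₀ ℕ) (Δ : LowerSet (Finset (Fin q))) (d : ℕ) :
    FaceModule K V Δ (d + 1) →ₗ[MvPolynomial V K] FaceModule K V Δ d :=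
  Finsupp.linearCombination (MvPolynomial V K) fun σ : Face Δ (d + 1) =>
    ∑ a ∈ σ.1.attach, Finsupp.single (σ.erase a)
      (MvPolynomial.monomial (lcmExp u σ.1 - lcmExp u (σ.1.erase a.1))
        ((-1 : K) ^ (σ.1.filter (· < a.1)).card))

/-- The augmentation, sending the vertex `i` to its label `x ^ u i`. -/
def augmentation (u : Fin q → V →₀ ℕ) (Δ : LowerSet (Finset (Fin q))) :
    FaceModule K V Δ 0 →ₗ[MvPolynomial V K] MvPolynomial V K :=
  Finsupp.linearCombination (MvPolynomial V K) fun σ : Face Δ 0 =>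
    MvPolynomial.monomial (lcmExp u σ.1) (1 : K)

variable {K}

/-- The homogenized chain complex of `Δ` with labels `x ^ u i` is a minimal free resolution of the
ideal `I`. -/
structure SupportsMinimalResolution (u : Fin q → V →₀ ℕ) (Δ : LowerSet (Finset (Fin q)))
    (I : Ideal (MvPolynomial V K)) : Prop where
  range_augmentation : LinearMap.range (augmentation K u Δ) = I
  exact_zero : Function.Exact (boundary K u Δ 0) (augmentation K u Δ)
  exact_succ : ∀ d, Function.Exact (boundary K u Δ (d + 1)) (boundary K u Δ d)
  minimal : ∀ d, LinearMap.range (boundary K u Δ d) ≤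
    Ideal.span (Set.range (MvPolynomial.X : V → MvPolynomial V K)) •
      (⊤ : Submodule (MvPolynomial V K) (FaceModule K V Δ d))

/-- The exponents of the minimal monomial generators of a monomial ideal `I`: the monomials in `I`
that are minimal with respect to divisibility. -/
def minimalGenerators (I : Ideal (MvPolynomial V K)) : Set (V →₀ ℕ) :=
  {m | Minimal (fun m' => MvPolynomial.monomial m' (1 : K) ∈ I) m}

/-- The monomial ideal `I` has a Scarf resolution: for an enumeration `x ^ u 0, …, x ^ u (q-1)` of
its minimal monomial generators (the order only affects signs), the Scarf complex supports a
minimal free resolution of `I`. -/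
def HasScarfResolution (I : Ideal (MvPolynomial V K)) : Prop :=
  ∃ (q : ℕ) (u : Fin q → V →₀ ℕ), Function.Injective u ∧ Set.range u = minimalGenerators I ∧
    SupportsMinimalResolution u (scarfComplex u) I

variable (K)

/-- The vertex cover ideal `J(G)`, generated by the monomials `∏_{i ∈ W} x_i` over all minimal
vertex covers `W` of `G`. -/
def vertexCoverIdeal (G : SimpleGraph V) : Ideal (MvPolynomial V K) :=
  Ideal.span {p | ∃ W : Finset V, Minimal (fun W' : Finset V => G.IsVertexCover (W' : Set V)) W ∧
    p = ∏ i ∈ W, MvPolynomial.X i}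

end Scarf

end ScarfCover

namespace ScarfCover

/-! ### Sequences of monomials with a parent function -/

section Monomials

variable {V : Type*} {q : ℕ}

/-! Minimal vertex covers of `G` are the complements of the facets `F` of `Δ(Gᶜ)`, so the generators
of `J(G)` are the squarefree monomials `m_F` supported on these complements. Divisibility is reverse
inclusion of facets, and the lcm of two generators corresponds to the intersection of the two
facets.

In a leaf order a branch of `F_i` is therefore a parent `p(i) < i`: the monomial `lcm(m_{p(i)},
m_i)` divides `lcm(m_k, m_i)` for every `k < i`. Equivalently, the colon ideal `(m_0, ..., m_{i-1})
: m_i` is principal, generated by `lcm(m_{p(i)}, m_i) / m_i`. Hence the tree with edges `{p(i), i}`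
supports a resolution of length one (`exact_augmentation_of_isParent`, `boundary_zero_injective`).

Every Scarf face with at least two elements is such an edge (`eq_pair_of_mem_scarfComplex`). If all
tree edges are Scarf faces, the Scarf complex is the tree and resolves `J(G)`. Conversely, a missing
edge disconnects the tree and leaves a syzygy uncovered (`pair_mem_scarfComplex_of_exact`).

The edge `{p(i), i}` fails to be a Scarf face exactly when some other `m_k` divides its lcm. For `k
< i` this gives a second branch of `F_i`; for `k > i` it gives an inclusion `G_i ∩ F_i ⊆ G_k ∩ F_k`.
So sensitivity says that all tree edges are Scarf faces (`isSensitive_iff`). Having a Scarf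
resolution does not refer to a leaf order, so one sensitive order forces all of them to be
sensitive. Dirac's theorem on simplicial vertices supplies at least one leaf order. -/

theorem lcmExp_singleton (u : Fin q → V →₀ ℕ) (a : Fin q) : lcmExp u {a} = u a := by
  simp [lcmExp]

theorem lcmExp_pair (u : Fin q → V →₀ ℕ) (a b : Fin q) : lcmExp u {a, b} = u a ⊔ u b := by
  simp [lcmExp]

theorem lcmExp_mono (u : Fin q → V →₀ ℕ) {σ τ : Finset (Fin q)} (h : σ ⊆ τ) :
    lcmExp u σ ≤ lcmExp u τ := Finset.sup_mono h

theorem le_lcmExp (u : Fin q → V →₀ ℕ) {σ : Finset (Fin q)} {a : Fin q} (h : a ∈ σ) :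
    u a ≤ lcmExp u σ := Finset.le_sup h

/-- A face of the Scarf complex contains every index whose label divides the label of the face. -/
theorem mem_of_le_lcmExp {u : Fin q → V →₀ ℕ} {σ : Finset (Fin q)} (hσ : σ ∈ scarfComplex u)
    {a : Fin q} (h : u a ≤ lcmExp u σ) : a ∈ σ := by
  have : insert a σ = σ := hσ _ (by
    unfold lcmExp at h ⊢
    rw [Finset.sup_insert]; exact sup_eq_right.2 h)
  rw [← this]; exact Finset.mem_insert_self _ _

/-- A label equal to `1` would be the lcm of the empty set, hence the hypothesis `h0`. -/
theorem singleton_mem_scarfComplex {u : Fin q → V →₀ ℕ} (hu : ∀ i j, u i ≤ u j → i = j)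
    (h0 : ∀ i, u i ≠ 0) (i : Fin q) : {i} ∈ scarfComplex u := by
  intro τ hτ
  rw [lcmExp_singleton] at hτ
  have hsub : ∀ a ∈ τ, a = i := fun a ha => hu _ _ (hτ ▸ le_lcmExp u ha)
  rcases τ.eq_empty_or_nonempty with rfl | ⟨a, ha⟩
  · exact absurd hτ.symm (h0 i)
  · exact Finset.eq_singleton_iff_unique_mem.2 ⟨hsub a ha ▸ ha, hsub⟩

/-- `p` is a parent of `i`: it precedes `i`, and among the least common multiples of `x ^ u i` with
an earlier monomial, the one with `x ^ u p` divides all the others. -/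
def IsParent (u : Fin q → V →₀ ℕ) (i p : Fin q) : Prop :=
  p < i ∧ ∀ k < i, u p ≤ u k ⊔ u i

/-- The faces of the Scarf complex with at least two elements are edges joining an index to its
parent. -/
theorem eq_pair_of_mem_scarfComplex {u : Fin q → V →₀ ℕ} {σ : Finset (Fin q)}
    (hσ : σ ∈ scarfComplex u) {i p : Fin q} (hi : i ∈ σ) (hmax : ∀ a ∈ σ, a ≤ i)
    (hp : IsParent u i p) (hcard : 1 < σ.card) : σ = {p, i} := by
  have hk : ∀ k ∈ σ, k ≠ i → u p ≤ u k ⊔ u i := fun k hk hne =>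
    hp.2 k (lt_of_le_of_ne (hmax k hk) hne)
  obtain ⟨k, hkσ, hki⟩ := Finset.exists_mem_ne hcard i
  have hpσ : p ∈ σ := mem_of_le_lcmExp hσ
    ((hk k hkσ hki).trans (sup_le (le_lcmExp u hkσ) (le_lcmExp u hi)))
  by_contra hne
  have hsub : ({p, i} : Finset (Fin q)) ⊆ σ := by
    simp [Finset.insert_subset_iff, hpσ, hi]
  obtain ⟨l, hlσ, hl⟩ : ∃ l ∈ σ, l ∉ ({p, i} : Finset (Fin q)) := by
    by_contra! h
    exact hne (Finset.Subset.antisymm h hsub)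
  simp only [Finset.mem_insert, Finset.mem_singleton, not_or] at hl
  -- A third element `l` already forces `m_p` to divide the lcm of the face without `p`, which must
  -- then contain `p`.
  have herase : σ.erase p ∈ scarfComplex u := (scarfComplex u).lower (Finset.erase_subset _ _) hσ
  have : p ∈ σ.erase p := mem_of_le_lcmExp herase
    ((hk l hlσ hl.2).trans (sup_le (le_lcmExp u (Finset.mem_erase.2 ⟨hl.1, hlσ⟩))
      (le_lcmExp u (Finset.mem_erase.2 ⟨hp.1.ne', hi⟩))))
  simp at this

theorem exists_eq_pair_of_mem_scarfComplex {u : Fin q → V →₀ ℕ} {p : Fin q → Fin q}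
    (hp : ∀ i : Fin q, 0 < (i : ℕ) → IsParent u i (p i)) {σ : Finset (Fin q)}
    (hσ : σ ∈ scarfComplex u) (hcard : 1 < σ.card) :
    ∃ i : Fin q, 0 < (i : ℕ) ∧ σ = {p i, i} := by
  have hne : σ.Nonempty := Finset.card_pos.1 (by omega)
  have hi := σ.max'_mem hne
  obtain ⟨k, hkσ, hki⟩ := Finset.exists_mem_ne hcard (σ.max' hne)
  have hpos : 0 < (σ.max' hne : ℕ) := by
    have : k < σ.max' hne := lt_of_le_of_ne (σ.le_max' k hkσ) hki
    have := Fin.lt_def.1 this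
    omega
  exact ⟨_, hpos, eq_pair_of_mem_scarfComplex hσ hi (fun a ha => σ.le_max' a ha) (hp _ hpos) hcard⟩

theorem pair_mem_scarfComplex {u : Fin q → V →₀ ℕ} (hu : ∀ i j, u i ≤ u j → i = j)
    {i p : Fin q} (hp : IsParent u i p) (h0 : u i ≠ 0) (h : ∀ k, u k ≤ u p ⊔ u i → k = p ∨ k = i) :
    {p, i} ∈ scarfComplex u := by
  intro τ hτ
  rw [lcmExp_pair] at hτ
  have hsub : ∀ a ∈ τ, a = p ∨ a = i := fun a ha => h a (hτ ▸ le_lcmExp u ha)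
  -- The hypothesis on `b` allows `τ` to be empty, so this also excludes the empty set.
  have key : ∀ b, (∀ a ∈ τ, a = b) → u p ≤ u b ∧ u i ≤ u b := fun b hb => by
    have : lcmExp u τ ≤ u b := Finset.sup_le fun a ha => by rw [hb a ha]
    rw [hτ] at this
    exact sup_le_iff.1 this
  have hiτ : i ∈ τ := by
    by_contra hi
    have := key p fun a ha => (hsub a ha).resolve_right fun h => hi (h ▸ ha)
    exact hp.1.ne' (hu _ _ this.2)
  have hpτ : p ∈ τ := by
    by_contra hi
    have := key i fun a ha => (hsub a ha).resolve_left fun h => hi (h ▸ ha)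
    exact hp.1.ne (hu _ _ this.1)
  ext a
  simp only [Finset.mem_insert, Finset.mem_singleton]
  exact ⟨hsub a, by rintro (rfl | rfl) <;> assumption⟩

/-- The parent of an index is unique if the two form a face of the Scarf complex. -/
theorem IsParent.unique {u : Fin q → V →₀ ℕ} {i p p' : Fin q} (hp : IsParent u i p)
    (hp' : IsParent u i p') (h : {p, i} ∈ scarfComplex u) : p' = p := by
  have := mem_of_le_lcmExp h (a := p') (by rw [lcmExp_pair]; exact hp'.2 p hp.1)
  simpa [hp'.1.ne] using this

/-- The face `{p, i}` contains every index whose label divides its lcm, hence both `p'` and `j`.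
Since `p' < j` and `p < i`, the larger elements agree. -/
theorem IsParent.eq_of_le {u : Fin q → V →₀ ℕ} {i j p p' : Fin q} (hp : IsParent u i p)
    (hp' : IsParent u j p') (h : {p, i} ∈ scarfComplex u) (hle : u p' ⊔ u j ≤ u p ⊔ u i) :
    i = j := by
  have h1 := mem_of_le_lcmExp h (a := p') (by rw [lcmExp_pair]; exact le_sup_left.trans hle)
  have h2 := mem_of_le_lcmExp h (a := j) (by rw [lcmExp_pair]; exact le_sup_right.trans hle)
  have a1 := hp.1
  have a2 := hp'.1
  simp only [Finset.mem_insert, Finset.mem_singleton] at h1 h2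
  rcases h2 with rfl | rfl
  · rcases h1 with rfl | rfl
    · exact absurd a2 (lt_irrefl _)
    · exact absurd (a1.trans a2) (lt_irrefl _)
  · rfl

end Monomials

/-! ### The homogenized chain complex -/

noncomputable section Complex

open MvPolynomial

variable {V : Type*} {q : ℕ} (K : Type*) [Field K]

/-- A vertex as a face of dimension `0`. -/
def vertexFace {Δ : LowerSet (Finset (Fin q))} (hv : ∀ i, {i} ∈ Δ) (i : Fin q) : Face Δ 0 :=
  ⟨{i}, hv i, by simp⟩

theorem vertexFace_injective {Δ : LowerSet (Finset (Fin q))} (hv : ∀ i, {i} ∈ Δ) :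
    Function.Injective (vertexFace hv) := fun i j h => by
  simpa [vertexFace] using h

theorem exists_vertexFace_eq {Δ : LowerSet (Finset (Fin q))} (hv : ∀ i, {i} ∈ Δ) (σ : Face Δ 0) :
    ∃ i, vertexFace hv i = σ := by
  obtain ⟨i, hi⟩ := Finset.card_eq_one.1 σ.2.2
  exact ⟨i, Subtype.ext hi.symm⟩

/-- An edge as a face of dimension `1`. -/
def edgeFace {Δ : LowerSet (Finset (Fin q))} {a b : Fin q} (hab : a < b) (h : {a, b} ∈ Δ) :
    Face Δ 1 :=
  ⟨{a, b}, h, Finset.card_pair hab.ne⟩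

theorem boundary_single_edgeFace (u : Fin q → V →₀ ℕ) {Δ : LowerSet (Finset (Fin q))}
    (hv : ∀ i, {i} ∈ Δ) {a b : Fin q} (hab : a < b) (h : {a, b} ∈ Δ) (g : MvPolynomial V K) :
    boundary K u Δ 0 (Finsupp.single (edgeFace hab h) g) =
      Finsupp.single (vertexFace hv b) (g * monomial (u a ⊔ u b - u b) 1) -
      Finsupp.single (vertexFace hv a) (g * monomial (u a ⊔ u b - u a) 1) := by
  have ha : a ∈ (edgeFace hab h).1 := by simp [edgeFace]
  have hb : b ∈ (edgeFace hab h).1 := by simp [edgeFace]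
  have hatt : (edgeFace hab h).1.attach = {⟨a, ha⟩, ⟨b, hb⟩} := by
    ext ⟨x, hx⟩
    have hx' := hx
    simp only [edgeFace, Finset.mem_insert, Finset.mem_singleton] at hx'
    simpa using hx'
  have ea : (edgeFace hab h).erase ⟨a, ha⟩ = vertexFace hv b := Subtype.ext (by
    simp [Face.erase, edgeFace, vertexFace, hab.ne])
  have eb : (edgeFace hab h).erase ⟨b, hb⟩ = vertexFace hv a := Subtype.ext (by
    simp only [Face.erase, edgeFace, vertexFace]
    rw [Finset.pair_comm, Finset.erase_insert (by simp [hab.ne'])])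
  have ea' : (edgeFace hab h).1.erase a = {b} := congrArg Subtype.val ea
  have eb' : (edgeFace hab h).1.erase b = {a} := congrArg Subtype.val eb
  have fa : (edgeFace hab h).1.filter (· < a) = ∅ := by
    simp [edgeFace, Finset.filter_insert, Finset.filter_singleton, hab.not_gt]
  have fb : (edgeFace hab h).1.filter (· < b) = {a} := by
    simp [edgeFace, Finset.filter_insert, Finset.filter_singleton, hab]
  rw [boundary, Finsupp.linearCombination_single, hatt,
    Finset.sum_pair (by simpa using hab.ne), ea, eb]
  simp only [ea', eb', fa, fb, lcmExp_singleton]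
  rw [show lcmExp u (edgeFace hab h).1 = u a ⊔ u b from lcmExp_pair u a b]
  simp [smul_add, Finsupp.smul_single, sub_eq_add_neg]

theorem exists_edgeFace_eq {Δ : LowerSet (Finset (Fin q))} (σ : Face Δ 1) :
    ∃ (a b : Fin q) (hab : a < b) (h : {a, b} ∈ Δ), σ = edgeFace hab h := by
  obtain ⟨σ, hσ, hc⟩ := σ
  obtain ⟨a, b, hab, rfl⟩ := Finset.card_eq_two.1 hc
  rcases lt_or_gt_of_ne hab with h | h
  · exact ⟨a, b, h, hσ, rfl⟩
  · exact ⟨b, a, h, by rwa [Finset.pair_comm], Subtype.ext (Finset.pair_comm _ _)⟩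

theorem augmentation_single_vertexFace (u : Fin q → V →₀ ℕ) {Δ : LowerSet (Finset (Fin q))}
    (hv : ∀ i, {i} ∈ Δ) (i : Fin q) (g : MvPolynomial V K) :
    augmentation K u Δ (Finsupp.single (vertexFace hv i) g) = g * monomial (u i) 1 := by
  rw [augmentation, Finsupp.linearCombination_single, smul_eq_mul]
  rw [show lcmExp u (vertexFace hv i).1 = u i from lcmExp_singleton u i]

theorem monomial_sup_sub_mul_left (s t : V →₀ ℕ) :
    (monomial (s ⊔ t - s) 1 * monomial s 1 : MvPolynomial V K) = monomial (s ⊔ t) 1 := by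
  rw [monomial_mul, tsub_add_cancel_of_le le_sup_left, one_mul]

theorem monomial_sup_sub_mul_right (s t : V →₀ ℕ) :
    (monomial (s ⊔ t - t) 1 * monomial t 1 : MvPolynomial V K) = monomial (s ⊔ t) 1 := by
  rw [monomial_mul, tsub_add_cancel_of_le le_sup_right, one_mul]

theorem augmentation_boundary (u : Fin q → V →₀ ℕ) {Δ : LowerSet (Finset (Fin q))}
    (hv : ∀ i, {i} ∈ Δ) (f : FaceModule K V Δ 1) :
    augmentation K u Δ (boundary K u Δ 0 f) = 0 := by
  induction f using Finsupp.induction_linear with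
  | zero => simp
  | add f g hf hg => rw [map_add, map_add, hf, hg, add_zero]
  | single σ g =>
    obtain ⟨a, b, hab, h, rfl⟩ := exists_edgeFace_eq σ
    rw [boundary_single_edgeFace K u hv, map_sub, augmentation_single_vertexFace,
      augmentation_single_vertexFace, mul_assoc, mul_assoc, monomial_sup_sub_mul_right,
      monomial_sup_sub_mul_left, sub_self]

theorem augmentation_apply (u : Fin q → V →₀ ℕ) {Δ : LowerSet (Finset (Fin q))}
    (hv : ∀ i, {i} ∈ Δ) (f : FaceModule K V Δ 0) :
    augmentation K u Δ f = ∑ i, f (vertexFace hv i) * monomial (u i) 1 := by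
  induction f using Finsupp.induction_linear with
  | zero => simp
  | add f g hf hg => simp only [map_add, hf, hg, Finsupp.add_apply, add_mul, Finset.sum_add_distrib]
  | single σ g =>
    obtain ⟨i, rfl⟩ := exists_vertexFace_eq hv σ
    rw [augmentation_single_vertexFace, Finset.sum_eq_single i]
    · simp
    · intro j _ hj
      rw [Finsupp.single_eq_of_ne (fun h => hj (vertexFace_injective hv h)), zero_mul]
    · simp

/-- If `f` times a monomial lies in the ideal of earlier monomials, then `f` is divisible by the
colon generator given by the parent. -/
theorem monomial_dvd_of_isParent {u : Fin q → V →₀ ℕ} {i p : Fin q} (hp : IsParent u i p)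
    (f : MvPolynomial V K)
    (hf : f * monomial (u i) 1 ∈ Ideal.span ((fun s => monomial s (1 : K)) '' (u '' Set.Iio i))) :
    monomial (u p ⊔ u i - u i) 1 ∣ f := by
  rw [← Ideal.mem_span_singleton, ← Set.image_singleton (f := fun s => monomial s (1 : K)),
    mem_ideal_span_monomial_image]
  rw [mem_ideal_span_monomial_image] at hf
  intro s hs
  refine ⟨_, rfl, ?_⟩
  obtain ⟨_, ⟨k, hk, rfl⟩, hle⟩ := hf (s + u i) (by
    rw [mem_support_iff, coeff_mul_monomial, mul_one]
    exact mem_support_iff.1 hs)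
  rw [tsub_le_iff_right]
  exact sup_le ((hp.2 k hk).trans (sup_le hle le_add_self)) le_add_self

/-- Syzygies are reduced to zero by clearing their last nonzero coefficient with a multiple of the
edge from that vertex to its parent. -/
theorem exact_augmentation_of_isParent {u : Fin q → V →₀ ℕ} {Δ : LowerSet (Finset (Fin q))}
    (hv : ∀ i, {i} ∈ Δ) {p : Fin q → Fin q} (hp : ∀ i : Fin q, 0 < (i : ℕ) → IsParent u i (p i))
    (he : ∀ i : Fin q, 0 < (i : ℕ) → {p i, i} ∈ Δ) :
    Function.Exact (boundary K u Δ 0) (augmentation K u Δ) := by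
  suffices H : ∀ n : ℕ, ∀ f : FaceModule K V Δ 0,
      (∀ i : Fin q, n ≤ (i : ℕ) → f (vertexFace hv i) = 0) → augmentation K u Δ f = 0 →
      f ∈ LinearMap.range (boundary K u Δ 0) by
    intro f
    constructor
    · intro hf
      exact H q f (fun i hi => absurd i.2 (by omega)) hf
    · rintro ⟨g, rfl⟩
      exact augmentation_boundary K u hv g
  intro n
  induction n with
  | zero =>
    intro f hf _
    have : f = 0 := Finsupp.ext fun σ => by
      obtain ⟨i, rfl⟩ := exists_vertexFace_eq hv σ
      exact hf i (Nat.zero_le _)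
    rw [this]; exact zero_mem _
  | succ n ih =>
    intro f hf haug
    by_cases hn : n < q
    swap
    · exact ih f (fun i hi => absurd i.2 (by omega)) haug
    have hsum := haug
    rw [augmentation_apply K u hv, ← Finset.add_sum_erase _ _ (Finset.mem_univ (⟨n, hn⟩ : Fin q))]
      at hsum
    -- Solving the syzygy relation for its last term puts that term in the ideal of the earlier
    -- generators.
    have hmem : f (vertexFace hv ⟨n, hn⟩) * monomial (u ⟨n, hn⟩) 1 ∈
        Ideal.span ((fun s => monomial s (1 : K)) '' (u '' Set.Iio (⟨n, hn⟩ : Fin q))) := by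
      rw [eq_neg_of_add_eq_zero_left hsum]
      refine neg_mem (Ideal.sum_mem _ fun i hi => ?_)
      by_cases hin : n < (i : ℕ)
      · rw [hf i hin, zero_mul]; exact zero_mem _
      · refine Ideal.mul_mem_left _ _ (Ideal.subset_span ⟨_, ⟨i, ?_, rfl⟩, rfl⟩)
        refine lt_of_le_of_ne (Fin.le_def.2 (not_lt.1 hin)) (Finset.ne_of_mem_erase hi)
    -- The first vertex has no parent, but there the ideal of earlier generators is zero, so the
    -- coefficient vanishes.
    rcases Nat.eq_zero_or_pos n with rfl | hpos
    · refine ih f (fun i _ => ?_) haug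
      by_cases hi : i = ⟨0, hn⟩
      · subst hi
        have hIio : Set.Iio (⟨0, hn⟩ : Fin q) = ∅ := by
          ext k; simp [Fin.lt_def]
        rw [hIio, Set.image_empty, Set.image_empty, Ideal.span_empty, Ideal.mem_bot] at hmem
        exact (mul_eq_zero.1 hmem).resolve_right (by simp [monomial_eq_zero])
      · exact hf i (by
          have : (i : ℕ) ≠ 0 := fun h => hi (Fin.ext h)
          omega)
    · have hP := hp ⟨n, hn⟩ hpos
      obtain ⟨g, hg⟩ := monomial_dvd_of_isParent K hP _ hmem
      have hb := boundary_single_edgeFace K u hv hP.1 (he ⟨n, hn⟩ hpos) g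
      set e := Finsupp.single (edgeFace hP.1 (he ⟨n, hn⟩ hpos)) g
      have := ih (f - boundary K u Δ 0 e) (fun i hi => ?_)
        (by rw [map_sub, haug, augmentation_boundary K u hv, sub_zero])
      · have h2 := add_mem this (LinearMap.mem_range_self (boundary K u Δ 0) e)
        rwa [sub_add_cancel] at h2
      · have hpi : i ≠ p ⟨n, hn⟩ := fun h => by
          have := Fin.lt_def.1 hP.1
          rw [← h] at this
          simp only at this
          omega
        rw [hb, Finsupp.sub_apply, Finsupp.sub_apply,
          Finsupp.single_eq_of_ne (fun h => hpi (vertexFace_injective hv h)), sub_zero]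
        by_cases hin : i = ⟨n, hn⟩
        · subst hin
          rw [Finsupp.single_eq_same, hg, mul_comm, sub_self]
        · rw [Finsupp.single_eq_of_ne (fun h => hin (vertexFace_injective hv h)), sub_zero]
          exact hf i (by
            have : (i : ℕ) ≠ n := fun h => hin (Fin.ext h)
            omega)

/-- The edges form a forest in which each edge is determined by its upper end. Among the edges in
the support of `f`, the one with the largest upper end is alone in meeting that vertex, so nothing
cancels its contribution there. -/
theorem boundary_zero_injective {u : Fin q → V →₀ ℕ} {Δ : LowerSet (Finset (Fin q))}
    (hv : ∀ i, {i} ∈ Δ) {p : Fin q → Fin q} (hp : ∀ i : Fin q, 0 < (i : ℕ) → p i < i)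
    (he : ∀ σ ∈ Δ, 1 < σ.card → ∃ i : Fin q, 0 < (i : ℕ) ∧ σ = {p i, i}) :
    Function.Injective (boundary K u Δ 0) := by
  have hrep : ∀ σ : Face Δ 1, ∃ (i : Fin q) (hi : p i < i) (h : {p i, i} ∈ Δ),
      σ = edgeFace hi h := by
    rintro ⟨σ, hσ, hc⟩
    obtain ⟨i, hi, rfl⟩ := he σ hσ (by omega)
    exact ⟨i, hp i hi, hσ, rfl⟩
  rw [injective_iff_map_eq_zero]
  intro f hf
  by_contra hne
  choose t ht1 ht2 ht3 using hrep
  obtain ⟨σ, hσ, hmax⟩ := Finset.exists_max_image f.support t (Finsupp.support_nonempty_iff.2 hne)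
  have hcoef : boundary K u Δ 0 f (vertexFace hv (t σ)) =
      f σ * monomial (u (p (t σ)) ⊔ u (t σ) - u (t σ)) 1 := by
    conv_lhs => rw [← Finsupp.sum_single f, Finsupp.sum, map_sum, Finsupp.finsetSum_apply]
    rw [Finset.sum_eq_single σ]
    · have hb := boundary_single_edgeFace K u hv (ht1 σ) (ht2 σ) (f σ)
      rw [← ht3 σ] at hb
      rw [hb, Finsupp.sub_apply, Finsupp.single_eq_same,
        Finsupp.single_eq_of_ne (fun h => (ht1 σ).ne' (vertexFace_injective hv h)), sub_zero]
    · intro τ hτ hτσ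
      have hne : t τ ≠ t σ := fun h => hτσ (by
        rw [ht3 τ, ht3 σ]; simp only [edgeFace, h])
      have hle := hmax τ hτ
      rw [ht3 τ, boundary_single_edgeFace K u hv, Finsupp.sub_apply,
        Finsupp.single_eq_of_ne (fun h => hne (vertexFace_injective hv h).symm),
        Finsupp.single_eq_of_ne (fun h => ((ht1 τ).trans_le hle).ne'
          (vertexFace_injective hv h)), sub_zero]
    · intro h
      exact absurd hσ h
  rw [hf, Finsupp.zero_apply] at hcoef
  rcases mul_eq_zero.1 hcoef.symm with h | h
  · exact Finsupp.mem_support_iff.1 hσ h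
  · simp [monomial_eq_zero] at h

theorem monomial_mem_span_X {s : V →₀ ℕ} (hs : s ≠ 0) (c : K) :
    monomial s c ∈ Ideal.span (Set.range (X : V → MvPolynomial V K)) := by
  classical
  obtain ⟨v, hv⟩ := Finsupp.ne_iff.1 hs
  rw [← Set.image_univ, mem_ideal_span_X_image]
  intro m hm
  obtain rfl : m = s := by
    by_contra h
    rw [mem_support_iff, coeff_monomial, if_neg (Ne.symm h)] at hm
    exact hm rfl
  exact ⟨v, Set.mem_univ _, hv⟩

/-- The differentials of the homogenized chain complex of the Scarf complex are minimal. -/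
theorem range_boundary_scarfComplex_le (u : Fin q → V →₀ ℕ) (d : ℕ) :
    LinearMap.range (boundary K u (scarfComplex u) d) ≤
      Ideal.span (Set.range (X : V → MvPolynomial V K)) •
        (⊤ : Submodule (MvPolynomial V K) (FaceModule K V (scarfComplex u) d)) := by
  rw [boundary, Finsupp.range_linearCombination, Submodule.span_le]
  rintro _ ⟨σ, rfl⟩
  refine Submodule.sum_mem _ fun a _ => ?_
  rw [← mul_one (monomial _ _), ← smul_eq_mul, ← Finsupp.smul_single]
  refine Submodule.smul_mem_smul (monomial_mem_span_X K ?_ _) Submodule.mem_top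
  -- A quotient equal to `1` would give `σ` and `σ \ {a}` the same lcm.
  intro h
  have hle := tsub_eq_zero_iff_le.1 h
  have := σ.2.1 _ (le_antisymm (lcmExp_mono u (Finset.erase_subset _ _)) hle)
  exact Finset.notMem_erase a.1 σ.1 (this.symm ▸ a.2)

theorem supportsMinimalResolution_scarfComplex {u : Fin q → V →₀ ℕ} {p : Fin q → Fin q}
    (hv : ∀ i, {i} ∈ scarfComplex u)
    (hp : ∀ i : Fin q, 0 < (i : ℕ) → IsParent u i (p i))
    (he : ∀ i : Fin q, 0 < (i : ℕ) → {p i, i} ∈ scarfComplex u) :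
    SupportsMinimalResolution u (scarfComplex u)
      (Ideal.span ((fun s => monomial s (1 : K)) '' Set.range u)) := by
  have hedge : ∀ σ ∈ scarfComplex u, 1 < σ.card → ∃ i : Fin q, 0 < (i : ℕ) ∧ σ = {p i, i} :=
    fun σ hσ hc => exists_eq_pair_of_mem_scarfComplex hp hσ hc
  -- Scarf faces have at most two elements, so the complex vanishes from homological degree two on.
  have hempty : ∀ d, IsEmpty (Face (scarfComplex u) (d + 2)) := fun d => ⟨fun σ => by
    obtain ⟨i, _, hi⟩ := hedge σ.1 σ.2.1 (by rw [σ.2.2]; omega)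
    have h1 := σ.2.2
    have h2 := Finset.card_le_two (a := p i) (b := i)
    rw [← hi] at h2
    omega⟩
  refine ⟨?_, exact_augmentation_of_isParent K hv hp he, ?_, range_boundary_scarfComplex_le K u⟩
  · rw [augmentation, Finsupp.range_linearCombination, Ideal.span]
    congr 1
    ext x
    constructor
    · rintro ⟨σ, rfl⟩
      obtain ⟨i, rfl⟩ := exists_vertexFace_eq hv σ
      exact ⟨u i, ⟨i, rfl⟩, by simp [vertexFace, lcmExp_singleton]⟩
    · rintro ⟨_, ⟨i, rfl⟩, rfl⟩
      exact ⟨vertexFace hv i, by simp [vertexFace, lcmExp_singleton]⟩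
  · intro d f
    have h0 : f = 0 → f ∈ Set.range (boundary K u (scarfComplex u) (d + 1)) := fun h =>
      ⟨0, by rw [map_zero, h]⟩
    have h1 : f ∈ Set.range (boundary K u (scarfComplex u) (d + 1)) → f = 0 := by
      rintro ⟨g, rfl⟩
      have := hempty d
      rw [Subsingleton.elim g 0, map_zero]
    refine ⟨fun hf => h0 ?_, fun hf => by rw [h1 hf, map_zero]⟩
    cases d with
    | zero =>
      exact boundary_zero_injective K hv (fun i hi => (hp i hi).1) hedge (hf.trans (map_zero _).symm)
    | succ d =>
      have := hempty d
      exact Subsingleton.elim _ _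

/-! ### Necessity of the tree edges. -/

theorem map_symm_mem_scarfComplex {r : ℕ} {u : Fin q → V →₀ ℕ} (e : Fin r ≃ Fin q)
    {σ : Finset (Fin q)} (hσ : σ ∈ scarfComplex u) :
    σ.map e.symm.toEmbedding ∈ scarfComplex (u ∘ e) := by
  intro τ hτ
  have h1 : τ.map e.toEmbedding = σ := hσ _ (by
    simp only [lcmExp, Finset.sup_map] at hτ ⊢
    refine Eq.trans ?_ (hτ.trans ?_)
    · rfl
    · congr 1
      ext a : 1
      simp)
  rw [← h1, Finset.map_map]
  ext a
  simp

/-- If the Scarf complex of `u` supports a resolution, then every index and its parent, with respect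
to any ordering `e`, form an edge of the Scarf complex. -/
theorem pair_mem_scarfComplex_of_exact {r : ℕ} {u : Fin q → V →₀ ℕ} (e : Fin r ≃ Fin q)
    (hv : ∀ i, {i} ∈ scarfComplex u) {p : Fin r → Fin r}
    (hp : ∀ i : Fin r, 0 < (i : ℕ) → IsParent (u ∘ e) i (p i))
    (hexact : Function.Exact (boundary K u (scarfComplex u) 0) (augmentation K u (scarfComplex u)))
    {i : Fin r} (hi : 0 < (i : ℕ)) : {e (p i), e i} ∈ scarfComplex u := by
  classical
  by_contra hno
  -- The parent map, made total by fixing index `0`, where `p` carries no information.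
  let P : Fin r → Fin r := fun j => if 0 < (j : ℕ) then p j else j
  have hPle : ∀ j, P j ≤ j := fun j => by
    by_cases hj : 0 < (j : ℕ)
    · simp only [P, if_pos hj]; exact (hp j hj).1.le
    · simp only [P, if_neg hj]; exact le_rfl
  -- the subtree of descendants of `i`
  let A : Fin r → Prop := fun j => ∃ n : ℕ, P^[n] j = i
  have hAi : A i := ⟨0, rfl⟩
  have hApi : ¬ A (p i) := by
    rintro ⟨n, hn⟩
    have : ∀ m : ℕ, P^[m] (p i) ≤ p i := fun m => by
      induction m with
      | zero => exact le_rfl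
      | succ m ih => rw [Function.iterate_succ_apply']; exact (hPle _).trans ih
    have h2 := this n
    rw [hn] at h2
    exact absurd (hp i hi).1 (not_lt.2 h2)
  have hAp : ∀ k : Fin r, 0 < (k : ℕ) → k ≠ i → (A (p k) ↔ A k) := by
    intro k hk hki
    have hPk : P k = p k := if_pos hk
    constructor
    · rintro ⟨n, hn⟩
      exact ⟨n + 1, by rw [Function.iterate_succ_apply, hPk, hn]⟩
    · rintro ⟨n, hn⟩
      cases n with
      | zero => exact absurd hn hki
      | succ n => exact ⟨n, by rwa [Function.iterate_succ_apply, hPk] at hn⟩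
  -- Only the edge from `i` to its parent leaves the subtree, and it is assumed not to be a Scarf
  -- face.
  have hedge : ∀ a b, a < b → {a, b} ∈ scarfComplex u → (A (e.symm a) ↔ A (e.symm b)) := by
    intro a b hab h
    obtain ⟨k, hk, hτ⟩ := exists_eq_pair_of_mem_scarfComplex hp (map_symm_mem_scarfComplex e h)
      (by rw [Finset.card_map, Finset.card_pair hab.ne]; omega)
    have hσ : ({a, b} : Finset (Fin q)) = {e (p k), e k} := by
      have := congrArg (Finset.map e.toEmbedding) hτ
      simpa [Finset.map_map, Finset.map_insert] using this
    have hki : k ≠ i := by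
      rintro rfl
      exact hno (hσ ▸ h)
    have hiff := hAp k hk hki
    have h1 : a = e (p k) ∨ a = e k := by
      have : a ∈ ({a, b} : Finset (Fin q)) := by simp
      rw [hσ] at this; simpa using this
    have h2 : b = e (p k) ∨ b = e k := by
      have : b ∈ ({a, b} : Finset (Fin q)) := by simp
      rw [hσ] at this; simpa using this
    rcases h1 with rfl | rfl <;> rcases h2 with rfl | rfl <;> simp [hiff]
  -- The augmentation restricted to the vertices of the subtree. It kills every boundary because no
  -- Scarf edge crosses between the subtree and the rest.
  let φ : FaceModule K V (scarfComplex u) 0 →ₗ[MvPolynomial V K] MvPolynomial V K :=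
    Finsupp.linearCombination (MvPolynomial V K) fun σ =>
      if ∃ k, σ = vertexFace hv k ∧ A (e.symm k) then monomial (lcmExp u σ.1) 1 else 0
  have hφ : ∀ k g, φ (Finsupp.single (vertexFace hv k) g) =
      if A (e.symm k) then g * monomial (u k) 1 else 0 := by
    intro k g
    have hiff : (∃ l, vertexFace hv k = vertexFace hv l ∧ A (e.symm l)) ↔ A (e.symm k) :=
      ⟨fun ⟨l, hl, hA⟩ => vertexFace_injective hv hl ▸ hA, fun h => ⟨k, rfl, h⟩⟩
    simp only [φ, Finsupp.linearCombination_single, hiff, smul_eq_mul]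
    rw [show lcmExp u (vertexFace hv k).1 = u k from lcmExp_singleton u k]
    split_ifs <;> simp
  have hφb : ∀ f, φ (boundary K u (scarfComplex u) 0 f) = 0 := by
    intro f
    induction f using Finsupp.induction_linear with
    | zero => simp
    | add f g hf hg => rw [map_add, map_add, hf, hg, add_zero]
    | single σ g =>
      obtain ⟨a, b, hab, h, rfl⟩ := exists_edgeFace_eq σ
      rw [boundary_single_edgeFace K u hv, map_sub, hφ, hφ, mul_assoc, mul_assoc,
        monomial_sup_sub_mul_right, monomial_sup_sub_mul_left, if_congr (hedge a b hab h) rfl rfl,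
        sub_self]
  -- The syzygy between `e i` and `e (p i)` is a boundary by exactness, yet `φ` sees only its term
  -- at `e i` and sends it to a nonzero lcm.
  obtain ⟨f, hf⟩ := (hexact
    (Finsupp.single (vertexFace hv (e i)) (monomial (u (e (p i)) ⊔ u (e i) - u (e i)) 1) -
      Finsupp.single (vertexFace hv (e (p i)))
        (monomial (u (e (p i)) ⊔ u (e i) - u (e (p i))) 1))).1 (by
    rw [map_sub, augmentation_single_vertexFace, augmentation_single_vertexFace,
      monomial_sup_sub_mul_right, monomial_sup_sub_mul_left, sub_self])
  have h0 := hφb f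
  rw [hf, map_sub, hφ, hφ, e.symm_apply_apply, e.symm_apply_apply, if_pos hAi, if_neg hApi,
    sub_zero, monomial_sup_sub_mul_right] at h0
  simp [monomial_eq_zero] at h0

end Complex

end ScarfCover

namespace ScarfCover

/-! ### Chordal graphs have leaf orders -/

section Chordal

variable {V : Type*} {H : SimpleGraph V}

theorem mk_getVert_mem_edges {s t : V} (p : H.Walk s t) {i : ℕ} (hi : i < p.length) :
    s(p.getVert i, p.getVert (i + 1)) ∈ p.edges := by
  induction p generalizing i with
  | nil => simp at hi
  | cons h p ih =>
    cases i with
    | zero => simp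
    | succ i =>
      rw [SimpleGraph.Walk.edges_cons]
      exact List.mem_cons_of_mem _ (ih (by simpa using hi))

/-- In a chordal graph, two neighbours `s`, `t` of `v` joined by a walk whose inner vertices are
different from `v` and not adjacent to `v` are adjacent. -/
theorem IsChordal.adj_of_walk (hH : IsChordal H) {v s t : V} (hvs : H.Adj v s) (hvt : H.Adj v t)
    (hst : s ≠ t) {D : Set V} (hD : ∀ x ∈ D, x ≠ v ∧ ¬ H.Adj v x) (p : H.Walk s t)
    (hp : ∀ x ∈ p.support, x ∈ D ∨ x = s ∨ x = t) : H.Adj s t := by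
  classical
  obtain ⟨n, hn⟩ : ∃ n, p.length = n := ⟨_, rfl⟩
  induction n using Nat.strong_induction_on generalizing p with
  | _ n ih =>
    by_contra hadj
    have hlen := p.length_bypass_le_length
    have hpath := p.bypass_isPath
    have hsup : ∀ x ∈ p.bypass.support, x ∈ D ∨ x = s ∨ x = t := fun x hx =>
      hp x (p.support_bypass_subset_support hx)
    generalize p.bypass = r at hlen hpath hsup
    have hvr : v ∉ r.support := fun h => by
      rcases hsup v h with h | h | h
      · exact (hD v h).1 rfl
      · exact hvs.ne h
      · exact hvt.ne h
    have hr2 : 2 ≤ r.length := by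
      by_contra! h
      interval_cases hl : r.length
      · exact hst (SimpleGraph.Walk.eq_of_length_eq_zero hl)
      · exact hadj (SimpleGraph.Walk.adj_of_length_eq_one hl)
    -- A path from `s` to `t` of length at least two closes up through `v` to a cycle of length at
    -- least four.
    have hcyc : (SimpleGraph.Walk.cons hvs (r.concat hvt.symm)).IsCycle := by
      rw [SimpleGraph.Walk.cons_isCycle_iff]
      refine ⟨hpath.concat hvr hvt.symm, ?_⟩
      rw [SimpleGraph.Walk.edges_concat]
      simp only [List.concat_eq_append, List.mem_append, List.mem_singleton, not_or]
      refine ⟨fun h => hvr (r.fst_mem_support_of_mem_edges h), fun h => ?_⟩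
      rw [Sym2.eq_swap, Sym2.eq_iff] at h
      rcases h with ⟨h, _⟩ | ⟨h, _⟩
      · exact hst h
      · exact hvs.ne h.symm
    obtain ⟨a, ha, b, hb, hab, hchord⟩ := hH v _ hcyc (by simp; omega)
    -- The only neighbours of `v` on the path are `s` and `t`, whose edges to `v` lie on the cycle;
    -- so a chord cannot end at `v`.
    have hnv : ∀ x, x ∈ r.support → H.Adj v x →
        s(v, x) ∈ (SimpleGraph.Walk.cons hvs (r.concat hvt.symm)).edges := by
      intro x hx hvx
      rw [SimpleGraph.Walk.edges_cons, SimpleGraph.Walk.edges_concat]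
      rcases hsup x hx with h | rfl | rfl
      · exact absurd hvx (hD x h).2
      · simp
      · simp [Sym2.eq_swap]
    have hmem : ∀ x, x ∈ (SimpleGraph.Walk.cons hvs (r.concat hvt.symm)).support →
        x = v ∨ x ∈ r.support := by
      intro x hx
      rw [SimpleGraph.Walk.support_cons, SimpleGraph.Walk.support_concat] at hx
      simp at hx
      tauto
    have har : a ∈ r.support := by
      rcases hmem a ha with rfl | h
      · rcases hmem b hb with rfl | h
        · exact absurd rfl hab.ne
        · exact absurd (hnv b h hab) hchord
      · exact h
    have hbr : b ∈ r.support := by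
      rcases hmem b hb with rfl | h
      · exact absurd (Sym2.eq_swap ▸ hnv a har hab.symm) hchord
      · exact h
    have hchord' : s(a, b) ∉ r.edges := fun h => hchord (by
      rw [SimpleGraph.Walk.edges_cons, SimpleGraph.Walk.edges_concat]
      simp [h])
    obtain ⟨i, rfl, hi⟩ := SimpleGraph.Walk.mem_support_iff_exists_getVert.1 har
    obtain ⟨j, rfl, hj⟩ := SimpleGraph.Walk.mem_support_iff_exists_getVert.1 hbr
    -- A chord between two path vertices shortcuts the walk, and the induction hypothesis applies to
    -- the shorter one.
    have key : ∀ i j : ℕ, i < j → j ≤ r.length → H.Adj (r.getVert i) (r.getVert j) →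
        s(r.getVert i, r.getVert j) ∉ r.edges → False := by
      intro i j hij hj hadj' hnot
      have hj1 : j ≠ i + 1 := by
        rintro rfl
        exact hnot (mk_getVert_mem_edges r (by omega))
      refine hadj (ih _ ?_ ((r.take i).append (SimpleGraph.Walk.cons hadj' (r.drop j))) ?_ rfl)
      · rw [SimpleGraph.Walk.length_append, SimpleGraph.Walk.length_cons,
          SimpleGraph.Walk.take_length, SimpleGraph.Walk.drop_length]
        omega
      · intro x hx
        rw [SimpleGraph.Walk.mem_support_append_iff, SimpleGraph.Walk.support_cons,
          List.mem_cons] at hx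
        refine hsup x ?_
        rcases hx with hx | rfl | hx
        · exact (r.isSubwalk_take i).support_subset hx
        · exact r.getVert_mem_support i
        · exact (r.isSubwalk_drop j).support_subset hx
    rcases lt_trichotomy i j with h | rfl | h
    · exact key i j h hj hab hchord'
    · exact hab.ne rfl
    · exact key j i h hi hab.symm (by rwa [Sym2.eq_swap])

/-- `B` is a maximal clique of the subgraph of `H` induced on `A`. -/
def IsMaxCliqueIn (H : SimpleGraph V) (A B : Finset V) : Prop :=
  Maximal (fun C : Finset V => C ⊆ A ∧ H.IsClique (C : Set V)) B

theorem exists_isMaxCliqueIn {A N : Finset V} (hNA : N ⊆ A) (hN : H.IsClique (N : Set V)) :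
    ∃ B, IsMaxCliqueIn H A B ∧ N ⊆ B := by
  have hfin : {C : Finset V | C ⊆ A ∧ H.IsClique (C : Set V)}.Finite :=
    A.powerset.finite_toSet.subset fun C hC => by simpa using hC.1
  obtain ⟨B, hNB, hB⟩ := hfin.exists_le_maximal (a := N) ⟨hNA, hN⟩
  exact ⟨B, hB, hNB⟩

variable [DecidableEq V]

/-- Dirac's theorem: in an induced subgraph of a chordal graph, every vertex that is not adjacent to
all the others has a non-neighbour that is simplicial. -/
theorem IsChordal.exists_simplicial (hH : IsChordal H) (A : Finset V) :
    ∀ v ∈ A, (∃ w ∈ A, w ≠ v ∧ ¬ H.Adj v w) →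
      ∃ w ∈ A, w ≠ v ∧ ¬ H.Adj v w ∧ H.IsClique {x | x ∈ A ∧ H.Adj w x} := by
  classical
  induction A using Finset.strongInduction with
  | H A ih =>
    rintro v hv ⟨w, hw, hwv, hvw⟩
    -- the connected component of `w` after deleting `v` and its neighbours
    let good : V → Prop := fun y => y ∈ A ∧ y ≠ v ∧ ¬ H.Adj v y
    let C : Set V := {x | ∃ p : H.Walk w x, ∀ y ∈ p.support, good y}
    -- The outer boundary of the component `C` in `A`. It consists of neighbours of `v`, and any two
    -- of its vertices are joined by a walk through `C`, so it is a clique.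
    let S : Set V := {s | s ∈ A ∧ s ∉ C ∧ ∃ c ∈ C, H.Adj c s}
    have hwC : w ∈ C := ⟨.nil, by simp [good, hw, hwv, hvw]⟩
    have hCgood : ∀ x ∈ C, good x := fun x ⟨p, hp⟩ => hp x p.end_mem_support
    have hCext : ∀ c ∈ C, ∀ y, H.Adj c y → good y → y ∈ C := by
      rintro c ⟨p, hp⟩ y hcy hy
      refine ⟨p.concat hcy, fun z hz => ?_⟩
      rw [SimpleGraph.Walk.support_concat] at hz
      simp at hz
      rcases hz with hz | rfl
      · exact hp z hz
      · exact hy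
    have hSv : ∀ s ∈ S, H.Adj v s := by
      rintro s ⟨hsA, hsC, c, hc, hcs⟩
      by_contra hvs
      refine hsC (hCext c hc s hcs ⟨hsA, ?_, hvs⟩)
      rintro rfl
      exact (hCgood c hc).2.2 hcs.symm
    have hSclique : ∀ s ∈ S, ∀ t ∈ S, s ≠ t → H.Adj s t := by
      intro s hs t ht hst
      obtain ⟨_, _, c, ⟨p, hp⟩, hcs⟩ := id hs
      obtain ⟨_, _, d, ⟨r, hr⟩, hdt⟩ := id ht
      refine hH.adj_of_walk (hSv s hs) (hSv t ht) hst (D := {x | good x})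
        (fun x hx => hx.2) (.cons hcs.symm (p.reverse.append (r.concat hdt))) fun x hx => ?_
      rw [SimpleGraph.Walk.support_cons, List.mem_cons, SimpleGraph.Walk.mem_support_append_iff,
        SimpleGraph.Walk.support_reverse, SimpleGraph.Walk.support_concat] at hx
      simp at hx
      rcases hx with rfl | hx | hx | rfl
      · exact Or.inr (Or.inl rfl)
      · exact Or.inl (hp x hx)
      · exact Or.inl (hr x hx)
      · exact Or.inr (Or.inr rfl)
    let B : Finset V := A.filter fun x => x ∈ C ∨ x ∈ S
    have hBmem : ∀ x, x ∈ B ↔ x ∈ C ∨ x ∈ S := fun x => by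
      simp only [B, Finset.mem_filter, and_iff_right_iff_imp]
      rintro (h | h)
      · exact (hCgood x h).1
      · exact h.1
    have hBA : B ⊂ A := by
      refine Finset.ssubset_iff_subset_ne.2 ⟨Finset.filter_subset _ _, fun h => ?_⟩
      rw [← h, hBmem] at hv
      rcases hv with h | h
      · exact (hCgood v h).2.1 rfl
      · exact (hSv v h).ne rfl
    -- A vertex of `C` has all its `A`-neighbours in `C ∪ S = B`, so being simplicial in `B`
    -- suffices.
    suffices ∃ z ∈ C, H.IsClique {x | x ∈ B ∧ H.Adj z x} by
      obtain ⟨z, hz, hcl⟩ := this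
      refine ⟨z, (hCgood z hz).1, (hCgood z hz).2.1, (hCgood z hz).2.2, hcl.subset ?_⟩
      rintro x ⟨hxA, hzx⟩
      refine ⟨(hBmem x).2 ?_, hzx⟩
      by_cases hx : x ∈ C
      · exact Or.inl hx
      · exact Or.inr ⟨hxA, hx, z, hz, hzx⟩
    -- A simplicial non-neighbour of some `s ∈ S` falls outside the clique `S`, hence in `C`.
    by_cases h1 : ∃ s ∈ S, ∃ w ∈ B, w ≠ s ∧ ¬ H.Adj s w
    · obtain ⟨s, hs, hex⟩ := h1
      obtain ⟨z, hzB, hzs, hsz, hcl⟩ := ih B hBA s ((hBmem s).2 (Or.inr hs)) hex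
      exact ⟨z, ((hBmem z).1 hzB).resolve_right fun h => hsz (hSclique s hs z h hzs.symm), hcl⟩
    push Not at h1
    -- Now every vertex of `S` is adjacent to the rest of `B`, so a non-neighbour of `c` again lies
    -- in `C`. If there is none, `B` is a clique and `w` works.
    by_cases h2 : ∃ c ∈ C, ∃ w ∈ B, w ≠ c ∧ ¬ H.Adj c w
    · obtain ⟨c, hc, hex⟩ := h2
      have hcB := (hBmem c).2 (Or.inl hc)
      obtain ⟨z, hzB, hzc, hcz, hcl⟩ := ih B hBA c hcB hex
      exact ⟨z, ((hBmem z).1 hzB).resolve_right fun h => hcz (h1 z h c hcB hzc.symm).symm, hcl⟩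
    push Not at h2
    refine ⟨w, hwC, ?_⟩
    rintro x ⟨hxB, _⟩ y ⟨hyB, _⟩ hxy
    rcases (hBmem x).1 hxB with hx | hx
    · exact h2 x hx y hyB hxy.symm
    · exact h1 x hx y hyB hxy.symm

theorem IsChordal.exists_simplicial_of_nonempty (hH : IsChordal H) {A : Finset V}
    (hA : A.Nonempty) : ∃ w ∈ A, H.IsClique {x | x ∈ A ∧ H.Adj w x} := by
  by_cases h : ∃ v ∈ A, ∃ w ∈ A, w ≠ v ∧ ¬ H.Adj v w
  · obtain ⟨v, hv, hex⟩ := h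
    obtain ⟨w, hw, _, _, hcl⟩ := hH.exists_simplicial A v hv hex
    exact ⟨w, hw, hcl⟩
  · push Not at h
    obtain ⟨w, hw⟩ := hA
    exact ⟨w, hw, fun x hx y hy hxy => h x hx.1 y hy.1 hxy.symm⟩

/-- The maximal cliques of a graph in terms of those of the deletion of a simplicial vertex. -/
theorem isMaxCliqueIn_iff_of_simplicial {A N : Finset V} {w : V} (hw : w ∈ A)
    (hN : ∀ x, x ∈ N ↔ x ∈ A ∧ H.Adj w x) (hcl : H.IsClique (N : Set V)) (B : Finset V) :
    IsMaxCliqueIn H A B ↔ B = insert w N ∨ (IsMaxCliqueIn H (A.erase w) B ∧ B ≠ N) := by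
  have hwN : w ∉ N := fun h => ((hN w).1 h).2.ne rfl
  have hNA : N ⊆ A.erase w := fun x hx =>
    Finset.mem_erase.2 ⟨fun h => hwN (h ▸ hx), ((hN x).1 hx).1⟩
  have hins : ∀ C : Finset V, C ⊆ N → insert w C ⊆ A ∧ H.IsClique (insert w C : Finset V) := by
    intro C hC
    refine ⟨Finset.insert_subset hw (hC.trans (hNA.trans (Finset.erase_subset _ _))), ?_⟩
    rw [Finset.coe_insert]
    exact (hcl.subset (Finset.coe_subset.2 hC)).insert fun b hb _ => ((hN b).1 (hC hb)).2
  have hsub : ∀ C : Finset V, C ⊆ A → H.IsClique (C : Set V) → w ∈ C → C ⊆ insert w N := by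
    intro C hCA hC hwC x hx
    by_cases hxw : x = w
    · simp [hxw]
    · exact Finset.mem_insert_of_mem ((hN x).2 ⟨hCA hx, hC hwC hx (Ne.symm hxw)⟩)
  have hers : ∀ C : Finset V, C ⊆ A → w ∉ C → C ⊆ A.erase w := fun C hCA hwC x hx =>
    Finset.mem_erase.2 ⟨fun h => hwC (h ▸ hx), hCA hx⟩
  constructor
  · intro hB
    by_cases hwB : w ∈ B
    · exact Or.inl ((hsub B hB.1.1 hB.1.2 hwB).antisymm
        (hB.2 (hins N subset_rfl) (hsub B hB.1.1 hB.1.2 hwB)))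
    · refine Or.inr ⟨⟨⟨hers B hB.1.1 hwB, hB.1.2⟩, fun C hC hBC =>
        hB.2 ⟨hC.1.trans (Finset.erase_subset _ _), hC.2⟩ hBC⟩, ?_⟩
      rintro rfl
      exact hwB (hB.2 (hins B subset_rfl) (Finset.subset_insert _ _) (Finset.mem_insert_self _ _))
  · rintro (rfl | ⟨hB, hBN⟩)
    · exact ⟨hins N subset_rfl, fun C hC hMC =>
        hsub C hC.1 hC.2 (hMC (Finset.mem_insert_self _ _))⟩
    · refine ⟨⟨hB.1.1.trans (Finset.erase_subset _ _), hB.1.2⟩, fun C hC hBC => ?_⟩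
      refine hB.2 ⟨hers C hC.1 fun hwC => hBN ?_, hC.2⟩ hBC
      have hBsub : B ⊆ N := fun x hx =>
        (Finset.mem_insert.1 (hsub C hC.1 hC.2 hwC (hBC hx))).resolve_left
          (Finset.mem_erase.1 (hB.1.1 hx)).1
      exact hBsub.antisymm (hB.2 ⟨hNA, hcl⟩ hBsub)

/-- Induction by deleting a simplicial vertex `w` with neighbourhood `N`. The only maximal clique
containing `w` is `N ∪ {w}`: it takes the place of `N` if `N` was maximal after the deletion, and
otherwise it goes last. -/
theorem IsChordal.exists_order_maxCliques (hH : IsChordal H) (A : Finset V) :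
    ∃ (q : ℕ) (F : Fin q → Finset V), Function.Injective F ∧
      (∀ B, (∃ i, F i = B) ↔ IsMaxCliqueIn H A B) ∧
      ∀ i : Fin q, 0 < (i : ℕ) → ∃ j < i, ∀ k < i, F k ∩ F i ⊆ F j := by
  classical
  obtain ⟨n, hn⟩ : ∃ n, A.card = n := ⟨_, rfl⟩
  induction n generalizing A with
  | zero =>
    obtain rfl := Finset.card_eq_zero.1 hn
    refine ⟨1, fun _ => ∅, Function.injective_of_subsingleton _, fun B => ?_, fun i hi => by omega⟩
    constructor
    · rintro ⟨_, rfl⟩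
      exact ⟨⟨subset_rfl, by simp⟩, fun C hC _ => hC.1⟩
    · intro hB
      exact ⟨0, (Finset.subset_empty.1 hB.1.1).symm⟩
  | succ n ih =>
    obtain ⟨w, hw, hcl⟩ := hH.exists_simplicial_of_nonempty (Finset.card_pos.1 (by omega : 0 < A.card))
    obtain ⟨q, F, hinj, hrange, hleaf⟩ := ih (A.erase w) (by
      rw [Finset.card_erase_of_mem hw]; omega)
    let N : Finset V := A.filter fun x => H.Adj w x
    have hN : ∀ x, x ∈ N ↔ x ∈ A ∧ H.Adj w x := fun x => by simp [N]
    have hNcl : H.IsClique (N : Set V) := hcl.subset fun x hx => (hN x).1 hx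
    have hchar := isMaxCliqueIn_iff_of_simplicial hw hN hNcl
    have hwF : ∀ i, w ∉ F i := fun i h =>
      (Finset.mem_erase.1 (((hrange _).1 ⟨i, rfl⟩).1.1 h)).1 rfl
    by_cases hNF : ∃ i, F i = N
    · obtain ⟨i₀, hi₀⟩ := hNF
      let F' := Function.update F i₀ (insert w N)
      have hF'0 : F' i₀ = insert w N := Function.update_self ..
      have hF' : ∀ i, i ≠ i₀ → F' i = F i := fun i hi => Function.update_of_ne hi ..
      have hle : ∀ i, F i ⊆ F' i := fun i => by
        by_cases hi : i = i₀
        · subst hi; rw [hF'0, hi₀]; exact Finset.subset_insert _ _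
        · rw [hF' i hi]
      have hge : ∀ i x, x ∈ F' i → x ∈ F i ∨ x = w := fun i x hx => by
        by_cases hi : i = i₀
        · subst hi
          rw [hF'0, ← hi₀, Finset.mem_insert] at hx
          exact hx.symm
        · rw [hF' i hi] at hx; exact Or.inl hx
      have hw' : ∀ i, w ∈ F' i → i = i₀ := fun i hwi => by
        by_contra hi
        rw [hF' i hi] at hwi
        exact hwF i hwi
      refine ⟨q, F', fun i j hij => ?_, fun B => ?_, fun i hi => ?_⟩
      · by_cases hi : i = i₀
        · have : w ∈ F' j := by rw [← hij, hi, hF'0]; exact Finset.mem_insert_self _ _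
          rw [hi, hw' j this]
        · by_cases hj : j = i₀
          · have : w ∈ F' i := by rw [hij, hj, hF'0]; exact Finset.mem_insert_self _ _
            rw [hj, hw' i this]
          · rw [hF' i hi, hF' j hj] at hij
            exact hinj hij
      · rw [hchar, ← hrange]
        constructor
        · rintro ⟨i, rfl⟩
          by_cases hi : i = i₀
          · subst hi; exact Or.inl hF'0
          · rw [hF' i hi, ← hi₀]
            exact Or.inr ⟨⟨i, rfl⟩, fun h => hi (hinj h)⟩
        · rintro (rfl | ⟨⟨i, rfl⟩, hne⟩)
          · exact ⟨i₀, hF'0⟩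
          · exact ⟨i, hF' i fun h => hne (h ▸ hi₀)⟩
      -- As `w` lies in only one clique, intersections of different cliques are unchanged.
      · obtain ⟨j, hj, hk⟩ := hleaf i hi
        refine ⟨j, hj, fun k hki x hx => ?_⟩
        obtain ⟨hxk, hxi⟩ := Finset.mem_inter.1 hx
        by_cases hxw : x = w
        · subst hxw
          exact absurd ((hw' k hxk).trans (hw' i hxi).symm) hki.ne
        · exact hle j (hk k hki (Finset.mem_inter.2
            ⟨(hge k x hxk).resolve_right hxw, (hge i x hxi).resolve_right hxw⟩))
    · have hNA : N ⊆ A.erase w := fun x hx =>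
        Finset.mem_erase.2 ⟨((hN x).1 hx).2.ne', ((hN x).1 hx).1⟩
      -- A maximal clique containing `N` serves as branch of the new last clique.
      obtain ⟨B₀, hB₀, hNB₀⟩ := exists_isMaxCliqueIn hNA hNcl
      obtain ⟨j₀, rfl⟩ := (hrange B₀).2 hB₀
      let F' : Fin (q + 1) → Finset V := Fin.snoc F (insert w N)
      have hlast : F' (Fin.last q) = insert w N := Fin.snoc_last ..
      have hcast : ∀ i : Fin q, F' i.castSucc = F i := fun i => Fin.snoc_castSucc ..
      have hne : ∀ i, F i ≠ insert w N := fun i h => hwF i (h ▸ Finset.mem_insert_self _ _)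
      refine ⟨q + 1, F', fun i j hij => ?_, fun B => ?_, fun i hi => ?_⟩
      · induction i using Fin.lastCases with
        | last =>
          induction j using Fin.lastCases with
          | last => rfl
          | cast j => rw [hlast, hcast] at hij; exact absurd hij.symm (hne j)
        | cast i =>
          induction j using Fin.lastCases with
          | last => rw [hlast, hcast] at hij; exact absurd hij (hne i)
          | cast j => rw [hcast, hcast] at hij; rw [hinj hij]
      · rw [hchar, ← hrange]
        constructor
        · rintro ⟨i, rfl⟩
          induction i using Fin.lastCases with
          | last => exact Or.inl hlast
          | cast i => rw [hcast]; exact Or.inr ⟨⟨i, rfl⟩, fun h => hNF ⟨i, h⟩⟩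
        · rintro (rfl | ⟨⟨i, rfl⟩, _⟩)
          · exact ⟨_, hlast⟩
          · exact ⟨_, hcast i⟩
      · induction i using Fin.lastCases with
        | last =>
          refine ⟨j₀.castSucc, Fin.castSucc_lt_last _, fun k hk x hx => ?_⟩
          induction k using Fin.lastCases with
          | last => exact absurd hk (lt_irrefl _)
          | cast k =>
            rw [hcast]
            rw [hcast, hlast, Finset.mem_inter, Finset.mem_insert] at hx
            exact hNB₀ (hx.2.resolve_left fun h => hwF k (h ▸ hx.1))
        | cast i =>
          obtain ⟨j, hj, hk⟩ := hleaf i (by simpa using hi)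
          refine ⟨j.castSucc, Fin.castSucc_lt_castSucc_iff.2 hj, fun k hki => ?_⟩
          induction k using Fin.lastCases with
          | last => exact absurd hki (not_lt.2 (Fin.castSucc_lt_last _).le)
          | cast k =>
            rw [hcast, hcast, hcast]
            exact hk k (Fin.castSucc_lt_castSucc_iff.1 hki)

end Chordal

end ScarfCover

namespace ScarfCover

/-! ### Leaf orders and vertex covers -/

section Facets

variable {V : Type*} {q : ℕ}

theorem isFacet_initialComplex_iff {F : Fin q → Finset V} (hF : ∀ i j, F i ⊆ F j → i = j)
    {i : Fin q} {A : Finset V} : IsFacet (initialComplex F i) A ↔ ∃ j ≤ i, A = F j := by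
  have hmem : ∀ A, A ∈ initialComplex F i ↔ ∃ j ≤ i, A ⊆ F j := fun A => Iff.rfl
  constructor
  · intro hA
    obtain ⟨j, hj, hAj⟩ := (hmem A).1 hA.1
    exact ⟨j, hj, hAj.antisymm (hA.2 ((hmem _).2 ⟨j, hj, subset_rfl⟩) hAj)⟩
  · rintro ⟨j, hj, rfl⟩
    refine ⟨(hmem _).2 ⟨j, hj, subset_rfl⟩, fun B hB hjB => ?_⟩
    obtain ⟨k, _, hBk⟩ := (hmem B).1 hB
    obtain rfl := hF j k (hjB.trans hBk)
    exact hBk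

variable [DecidableEq V]

/-- The antichain hypothesis makes `F_0, ..., F_i` exactly the facets of the initial complex, so
branches can be described by indices. -/
theorem isBranch_initialComplex_iff {F : Fin q → Finset V} (hF : ∀ i j, F i ⊆ F j → i = j)
    {i : Fin q} {B : Finset V} : IsBranch (initialComplex F i) (F i) B ↔
      ∃ j < i, B = F j ∧ ∀ k < i, F k ∩ F i ⊆ F j := by
  have hinj : ∀ {j k}, F j = F k → j = k := fun h => hF _ _ h.subset
  constructor
  · rintro ⟨hB, hne, hall⟩
    obtain ⟨j, hj, rfl⟩ := (isFacet_initialComplex_iff hF).1 hB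
    refine ⟨j, lt_of_le_of_ne hj fun h => hne (h ▸ rfl), rfl, fun k hk => ?_⟩
    exact (hall (F k) ((isFacet_initialComplex_iff hF).2 ⟨k, hk.le, rfl⟩)
      fun h => hk.ne (hinj h)).trans Finset.inter_subset_left
  · rintro ⟨j, hj, rfl, hall⟩
    refine ⟨(isFacet_initialComplex_iff hF).2 ⟨j, hj.le, rfl⟩, fun h => hj.ne (hinj h), ?_⟩
    intro A hA hne
    obtain ⟨k, hk, rfl⟩ := (isFacet_initialComplex_iff hF).1 hA
    exact Finset.subset_inter (hall k (lt_of_le_of_ne hk fun h => hne (h ▸ rfl)))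
      Finset.inter_subset_right

theorem IsLeafOrder.eq_of_subset {Δ : LowerSet (Finset V)} {F : Fin q → Finset V}
    (h : IsLeafOrder Δ F) (i j : Fin q) (hij : F i ⊆ F j) : i = j := by
  have hf : ∀ i, IsFacet Δ (F i) := fun i => by
    have : F i ∈ Set.range F := ⟨i, rfl⟩
    rwa [h.range_eq] at this
  exact h.injective (hij.antisymm ((hf i).2 (hf j).1 hij))

end Facets

/-! ### Generators of the vertex cover ideal and the translation of sensitivity. -/

noncomputable section CoverExponents

open MvPolynomial

theorem minimalGenerators_span_monomial {V K : Type*} [Field K] {U : Set (V →₀ ℕ)}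
    (hU : ∀ a ∈ U, ∀ b ∈ U, a ≤ b → a = b) :
    minimalGenerators (Ideal.span ((fun s => monomial s (1 : K)) '' U)) = U := by
  classical
  have hmem : ∀ m, monomial m (1 : K) ∈ Ideal.span ((fun s => monomial s (1 : K)) '' U) ↔
      ∃ a ∈ U, a ≤ m := by
    intro m
    rw [mem_ideal_span_monomial_image]
    simp
  ext m
  simp only [minimalGenerators, Set.mem_ofPred_eq, hmem]
  constructor
  · rintro ⟨⟨a, ha, ham⟩, hmin⟩
    rwa [ham.antisymm (hmin ⟨a, ha, le_rfl⟩ ham)] at ha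
  · intro hm
    refine ⟨⟨m, hm, le_rfl⟩, ?_⟩
    rintro b ⟨a, ha, hab⟩ hbm
    rwa [← hU a ha m hm (hab.trans hbm)]

variable {V : Type*} [Fintype V] [DecidableEq V] {q : ℕ}

/-- The exponent of the squarefree monomial supported on the complement of `A`. -/
def coverExp (A : Finset V) : V →₀ ℕ := ∑ i ∈ Aᶜ, Finsupp.single i 1

theorem coverExp_apply (A : Finset V) (v : V) : coverExp A v = if v ∈ A then 0 else 1 := by
  simp only [coverExp, Finsupp.finsetSum_apply, Finsupp.single_apply, Finset.sum_ite_eq',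
    Finset.mem_compl]
  split_ifs <;> simp_all

theorem coverExp_le_iff {A B : Finset V} : coverExp A ≤ coverExp B ↔ B ⊆ A := by
  rw [Finsupp.le_def]
  refine forall_congr' fun v => ?_
  rw [coverExp_apply, coverExp_apply]
  by_cases h1 : v ∈ A <;> by_cases h2 : v ∈ B <;> simp [h1, h2]

theorem coverExp_sup (A B : Finset V) : coverExp A ⊔ coverExp B = coverExp (A ∩ B) := by
  ext v
  rw [Finsupp.sup_apply, coverExp_apply, coverExp_apply, coverExp_apply]
  by_cases h1 : v ∈ A <;> by_cases h2 : v ∈ B <;> simp [h1, h2]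

theorem coverExp_injective : Function.Injective (coverExp : Finset V → V →₀ ℕ) := fun _ _ h =>
  (coverExp_le_iff.1 h.ge).antisymm (coverExp_le_iff.1 h.le)

theorem coverExp_ne_zero {A : Finset V} (hA : A ≠ Finset.univ) : coverExp A ≠ 0 := fun h => by
  refine hA (Finset.eq_univ_iff_forall.2 fun v => ?_)
  by_contra hv
  have := DFunLike.congr_fun h v
  simp [coverExp_apply, hv] at this

theorem monomial_coverExp_compl (K : Type*) [Field K] (W : Finset V) :
    monomial (coverExp Wᶜ) (1 : K) = ∏ i ∈ W, X i := by
  rw [coverExp, compl_compl, monomial_sum_one]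
  rfl

theorem isParent_coverExp_iff {F : Fin q → Finset V} {i p : Fin q} :
    IsParent (fun i => coverExp (F i)) i p ↔ p < i ∧ ∀ k < i, F k ∩ F i ⊆ F p := by
  simp only [IsParent, coverExp_sup, coverExp_le_iff]

theorem isBranch_iff_isParent {F : Fin q → Finset V} (hF : ∀ i j, F i ⊆ F j → i = j)
    {i : Fin q} {B : Finset V} : IsBranch (initialComplex F i) (F i) B ↔
      ∃ j, B = F j ∧ IsParent (fun i => coverExp (F i)) i j := by
  simp only [isBranch_initialComplex_iff hF, isParent_coverExp_iff]
  exact exists_congr fun j => by tauto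

/-- An order of facets in which every facet has a branch is sensitive if and only if all the pairs
consisting of a facet and its branch belong to the Scarf complex. -/
theorem isSensitive_iff {F : Fin q → Finset V} (hF : ∀ i j, F i ⊆ F j → i = j)
    (huniv : ∀ i, F i ≠ Finset.univ) {p : Fin q → Fin q}
    (hp : ∀ i : Fin q, 0 < (i : ℕ) → IsParent (fun i => coverExp (F i)) i (p i)) :
    IsSensitive F ↔
      ∀ i : Fin q, 0 < (i : ℕ) → {p i, i} ∈ scarfComplex fun i => coverExp (F i) := by
  have hbr : ∀ i : Fin q, 0 < (i : ℕ) → IsBranch (initialComplex F i) (F i) (F (p i)) :=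
    fun i hi => (isBranch_iff_isParent hF).2 ⟨_, rfl, hp i hi⟩
  constructor
  · intro hs i hi
    refine pair_mem_scarfComplex (fun a b h => (hF b a (coverExp_le_iff.1 h)).symm) (hp i hi)
      (coverExp_ne_zero (huniv i)) fun k hk => ?_
    rcases lt_trichotomy k i with hki | rfl | hik
    · left
      -- An earlier generator dividing the lcm of the edge is itself a parent of `i`, that is, a
      -- second branch.
      have hk' : IsParent (fun i => coverExp (F i)) i k :=
        ⟨hki, fun l hl => hk.trans (sup_le ((hp i hi).2 l hl) le_sup_right)⟩
      have := (hs.unique_branch i hi).unique ((isBranch_iff_isParent hF).2 ⟨_, rfl, hk'⟩) (hbr i hi)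
      exact hF _ _ this.subset
    · exact Or.inr rfl
    -- For a later generator `k`, its parent divides `lcm(m_i, m_k)` and hence the lcm of the edge
    -- at `i`. So the lcm of the edge at `k` divides that of the edge at `i`, against
    -- incomparability.
    · have hk0 : 0 < (k : ℕ) := lt_trans hi hik
      refine absurd ?_ (hs.incomparable i k hi hk0 hik.ne _ _ (hbr i hi) (hbr k hk0))
      rw [← coverExp_le_iff, ← coverExp_sup, ← coverExp_sup]
      exact sup_le (((hp k hk0).2 i hik).trans (sup_le le_sup_right hk)) hk
  · intro h
    refine ⟨fun i hi => ⟨F (p i), hbr i hi, fun B hB => ?_⟩, ?_⟩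
    · obtain ⟨j, rfl, hj⟩ := (isBranch_iff_isParent hF).1 hB
      rw [(hp i hi).unique hj (h i hi)]
    · intro i j hi hj hij B C hB hC hsub
      obtain ⟨b, rfl, hb⟩ := (isBranch_iff_isParent hF).1 hB
      obtain ⟨c, rfl, hc⟩ := (isBranch_iff_isParent hF).1 hC
      rw [(hp i hi).unique hb (h i hi)] at hsub
      rw [← coverExp_le_iff, ← coverExp_sup, ← coverExp_sup] at hsub
      exact hij ((hp i hi).eq_of_le hc (h i hi) hsub)

/-- Cliques of `Gᶜ` are independent sets of `G`, whose complements are the vertex covers;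
complementation exchanges maximal and minimal. -/
theorem isFacet_cliqueComplex_compl_iff {G : SimpleGraph V} {A : Finset V} :
    IsFacet (cliqueComplex Gᶜ) A ↔
      Minimal (fun W : Finset V => G.IsVertexCover (W : Set V)) Aᶜ := by
  have hcov : ∀ B : Finset V, B ∈ cliqueComplex Gᶜ ↔ G.IsVertexCover ((Bᶜ : Finset V) : Set V) := by
    intro B
    rw [Finset.coe_compl, SimpleGraph.isVertexCover_compl, ← SimpleGraph.isClique_compl]
    rfl
  constructor
  · rintro ⟨hA, hmax⟩
    refine ⟨(hcov A).1 hA, fun W hW hWA => ?_⟩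
    have := hmax (y := Wᶜ) ((hcov _).2 (by rwa [compl_compl])) (by
      exact Finset.subset_compl_comm.1 hWA)
    exact compl_le_iff_compl_le.1 this
  · rintro ⟨hA, hmin⟩
    refine ⟨(hcov A).2 hA, fun B hB hAB => ?_⟩
    exact Finset.compl_subset_compl.1 (hmin ((hcov B).1 hB) (Finset.compl_subset_compl.2 hAB))

theorem vertexCoverIdeal_eq_span (K : Type*) [Field K] (G : SimpleGraph V) :
    vertexCoverIdeal K G = Ideal.span
      ((fun s => monomial s (1 : K)) '' (coverExp '' {A | IsFacet (cliqueComplex Gᶜ) A})) := by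
  rw [vertexCoverIdeal]
  congr 1
  ext x
  constructor
  · rintro ⟨W, hW, rfl⟩
    exact ⟨_, ⟨Wᶜ, isFacet_cliqueComplex_compl_iff.2 (by rwa [compl_compl]), rfl⟩,
      monomial_coverExp_compl K W⟩
  · rintro ⟨_, ⟨A, hA, rfl⟩, rfl⟩
    exact ⟨Aᶜ, isFacet_cliqueComplex_compl_iff.1 hA, by
      simp only [← monomial_coverExp_compl, compl_compl]⟩

theorem minimalGenerators_vertexCoverIdeal (K : Type*) [Field K] (G : SimpleGraph V) :
    minimalGenerators (vertexCoverIdeal K G) =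
      coverExp '' {A | IsFacet (cliqueComplex Gᶜ) A} := by
  rw [vertexCoverIdeal_eq_span]
  refine minimalGenerators_span_monomial ?_
  rintro _ ⟨A, hA, rfl⟩ _ ⟨B, hB, rfl⟩ hAB
  have hBA := coverExp_le_iff.1 hAB
  rw [hBA.antisymm (hB.2 hA.1 hBA)]

theorem IsLeafOrder.exists_parent {Δ : LowerSet (Finset V)} {F : Fin q → Finset V}
    (h : IsLeafOrder Δ F) : ∃ p : Fin q → Fin q, ∀ i : Fin q, 0 < (i : ℕ) →
      IsParent (fun i => coverExp (F i)) i (p i) := by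
  have : ∀ i : Fin q, ∃ j, 0 < (i : ℕ) → IsParent (fun i => coverExp (F i)) i j := by
    intro i
    by_cases hi : 0 < (i : ℕ)
    · obtain ⟨B, hB⟩ := (h.isLeaf i hi).2
      obtain ⟨j, _, hj⟩ := (isBranch_iff_isParent h.eq_of_subset).1 hB
      exact ⟨j, fun _ => hj⟩
    · exact ⟨i, fun h => absurd h hi⟩
  choose p hp using this
  exact ⟨p, hp⟩

/-- An edge of `G` keeps the whole vertex set from being a clique of `Gᶜ`, so no generator of `J(G)`
is `1`. -/
theorem IsLeafOrder.ne_univ {G : SimpleGraph V} (hG : G ≠ ⊥) {F : Fin q → Finset V}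
    (h : IsLeafOrder (cliqueComplex Gᶜ) F) (i : Fin q) : F i ≠ Finset.univ := by
  intro hi
  have hf : IsFacet (cliqueComplex Gᶜ) (F i) := by
    have : F i ∈ Set.range F := ⟨i, rfl⟩
    rwa [h.range_eq] at this
  have hcl : Gᶜ.IsClique ((F i : Finset V) : Set V) := hf.1
  rw [hi] at hcl
  refine hG (SimpleGraph.eq_bot_iff_forall_not_adj.2 fun a b hab => ?_)
  exact (hcl (x := a) (by simp) (y := b) (by simp) hab.ne).2 hab

theorem exists_isLeafOrder {G : SimpleGraph V} (hchordal : IsChordal Gᶜ) :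
    ∃ (q : ℕ) (F : Fin q → Finset V), IsLeafOrder (cliqueComplex Gᶜ) F := by
  obtain ⟨q, F, hinj, hrange, hleaf⟩ := hchordal.exists_order_maxCliques Finset.univ
  have hfacet : ∀ B, IsMaxCliqueIn Gᶜ Finset.univ B ↔ IsFacet (cliqueComplex Gᶜ) B := fun B => by
    simp only [IsMaxCliqueIn, Finset.subset_univ, true_and]
    rfl
  have hF : ∀ i j, F i ⊆ F j → i = j := fun i j hij => by
    have hi := (hrange _).1 ⟨i, rfl⟩
    have hj := (hrange _).1 ⟨j, rfl⟩
    exact hinj (hij.antisymm (hi.2 hj.1 hij))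
  refine ⟨q, F, hinj, ?_, fun i hi => ⟨(isFacet_initialComplex_iff hF).2 ⟨i, le_rfl, rfl⟩, ?_⟩⟩
  · ext B
    exact (hrange B).trans (hfacet B)
  · obtain ⟨j, hj, hk⟩ := hleaf i hi
    exact ⟨F j, (isBranch_initialComplex_iff hF).2 ⟨j, hj, rfl, hk⟩⟩

/-! ### The implications between Scarf resolutions and sensitive leaf orders. -/

theorem hasScarfResolution_of_isSensitive (K : Type*) [Field K] {G : SimpleGraph V} (hG : G ≠ ⊥)
    {F : Fin q → Finset V} (hF : IsLeafOrder (cliqueComplex Gᶜ) F) (hs : IsSensitive F) :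
    HasScarfResolution (vertexCoverIdeal K G) := by
  obtain ⟨p, hp⟩ := hF.exists_parent
  have hrange : Set.range (fun i => coverExp (F i)) =
      coverExp '' {A | IsFacet (cliqueComplex Gᶜ) A} := by
    rw [← hF.range_eq, ← Set.range_comp]
    rfl
  refine ⟨q, fun i => coverExp (F i), coverExp_injective.comp hF.injective, ?_, ?_⟩
  · rw [minimalGenerators_vertexCoverIdeal, hrange]
  · rw [vertexCoverIdeal_eq_span, ← hrange]
    exact supportsMinimalResolution_scarfComplex K
      (singleton_mem_scarfComplex (fun a b h => (hF.eq_of_subset b a (coverExp_le_iff.1 h)).symm)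
        fun i => coverExp_ne_zero (hF.ne_univ hG i)) hp
      ((isSensitive_iff hF.eq_of_subset (hF.ne_univ hG) hp).1 hs)

theorem isSensitive_of_hasScarfResolution (K : Type*) [Field K] {G : SimpleGraph V} (hG : G ≠ ⊥)
    (hscarf : HasScarfResolution (vertexCoverIdeal K G)) {F : Fin q → Finset V}
    (hF : IsLeafOrder (cliqueComplex Gᶜ) F) : IsSensitive F := by
  obtain ⟨r, u, hinj, hrange, hres⟩ := hscarf
  obtain ⟨p, hp⟩ := hF.exists_parent
  rw [minimalGenerators_vertexCoverIdeal, ← hF.range_eq, ← Set.range_comp] at hrange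
  have hFinj : Function.Injective (coverExp ∘ F) := coverExp_injective.comp hF.injective
  -- The Scarf resolution comes with its own enumeration of the generators; `e` matches it with the
  -- given leaf order.
  let e : Fin q ≃ Fin r := (Equiv.ofInjective _ hFinj).trans
    ((Equiv.setCongr hrange.symm).trans (Equiv.ofInjective u hinj).symm)
  have he : ∀ i, u (e i) = coverExp (F i) := fun i =>
    Equiv.apply_ofInjective_symm hinj _
  have hue : u ∘ e = fun i => coverExp (F i) := funext he
  have hv : ∀ i, {i} ∈ scarfComplex u := by
    refine singleton_mem_scarfComplex (fun a b hab => ?_) fun i => ?_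
    · obtain ⟨a, rfl⟩ := e.surjective a
      obtain ⟨b, rfl⟩ := e.surjective b
      rw [he, he] at hab
      rw [hF.eq_of_subset b a (coverExp_le_iff.1 hab)]
    · obtain ⟨i, rfl⟩ := e.surjective i
      rw [he]
      exact coverExp_ne_zero (hF.ne_univ hG i)
  rw [isSensitive_iff hF.eq_of_subset (hF.ne_univ hG) hp]
  intro i hi
  have h := map_symm_mem_scarfComplex e
    (pair_mem_scarfComplex_of_exact K e hv (by rwa [hue]) hres.exact_zero hi)
  rw [hue] at h
  simpa [Finset.map_insert] using h

end CoverExponents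

end ScarfCover

theorem theorem2p3 {V : Type*} [Fintype V] [DecidableEq V] (K : Type*) [Field K]
    (G : SimpleGraph V) (hG : G ≠ ⊥) (hchordal : ScarfCover.IsChordal Gᶜ) :
    List.TFAE [
      ScarfCover.HasScarfResolution (ScarfCover.vertexCoverIdeal K G),
      ∃ (q : ℕ) (F : Fin q → Finset V),
        ScarfCover.IsLeafOrder (ScarfCover.cliqueComplex Gᶜ) F ∧ ScarfCover.IsSensitive F,
      ∀ (q : ℕ) (F : Fin q → Finset V),
        ScarfCover.IsLeafOrder (ScarfCover.cliqueComplex Gᶜ) F → ScarfCover.IsSensitive F] := by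
  tfae_have 1 → 3 := fun h _ _ hF => ScarfCover.isSensitive_of_hasScarfResolution K hG h hF
  tfae_have 3 → 2 := fun h => by
    obtain ⟨q, F, hF⟩ := ScarfCover.exists_isLeafOrder hchordal
    exact ⟨q, F, hF, h q F hF⟩
  tfae_have 2 → 1 := fun ⟨_, _, hF, hs⟩ => ScarfCover.hasScarfResolution_of_isSensitive K hG hF hs
  tfae_finish
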